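/- Fix a field $k$. For a finite poset $\mathcal{P}$, a $\mathcal{P}$-module is a functor from $\mathcal{P}$ to finite-dimensional $k$-vector spaces; $\mathrm{mod}\,\mathcal{P}$ is the abelian category of $\mathcal{P}$-modules, and $\mathrm{Ind}\,\mathcal{P}$ is the set of isomorphism classes of indecomposable $\mathcal{P}$-modules. Call $\mathcal{P}$ representation-finite if $\mathrm{Ind}\,\mathcal{P}$ is finite. For finite posets $\mathcal{X},\mathcal{P}$, let $\mathrm{Emb}_{\mathcal{X}}^{\mathcal{P}}$ be the set of order-embeddings $f:\mathcal{X}\to\mathcal{P}$ (i.e. $x\le x'\iff f(x)\le f(x')$) up to automorphisms of $\mathcal{X}$. Let $f^*:\mathrm{mod}\,\mathcal{P}\to\mathrm{mod}\,\mathcal{X}$ be restriction along $f$ and $f_!$ its left adjoint. Let $\mathcal{X}$ be a representation-finite finite poset, let $\mathcal{P}$ be a finite poset, and let $\mathrm{E}\subseteq \mathrm{Emb}_{\mathcal{X}}^{\mathcal{P}}$ satisfy $\mathcal{P}=\bigcup_{f\in\mathrm{E}}\operatorname{Im} f$. Let $$\mathcal{H}^{\mathrm{E}}=\{f_!U \mid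 f\in\mathrm{E},\ U\in \mathrm{Ind}\,\mathcal{X}\},$$ a set of isomorphism classes of $\mathcal{P}$-modules. Let $\mathcal{E}^{\mathrm{E}}_{\mathcal{P}}$ be the class of short exact sequences $0\to L\to M\to N\to 0$ in $\mathrm{mod}\,\mathcal{P}$ such that $0\to f^*L\to f^*M\to f^*N\to 0$ splits for every $f\in\mathrm{E}$. For a set $\mathcal{U}$ of (isomorphism classes of) $\mathcal{P}$-modules, let $\mathcal{E}_{\mathcal{U}}$ be the class of short exact sequences $0\to L\to M\xrightarrow{g} N\to 0$ in $\mathrm{mod}\,\mathcal{P}$ such that $\mathrm{Hom}_{\mathcal{P}}(U,g)$ is surjective for all $U\in\mathcal{U}$. Then: 1. $\mathcal{H}^{\mathrm{E}}\subseteq\mathrm{Ind}\,\mathcal{P}$, and $\mathcal{H}^{\mathrm{E}}$ contains every indecomposable projective $\mathcal{P}$-module. 2. $\mathcal{E}^{\mathrm{E}}_{\mathcal{P}}$ is an exact structure on $\mathrm{mod}\,\mathcal{P}$ (a class of short exact sequences, closed under isomorphism, that contains all split exact sequences, whose admissible monomorphisms are closed under composition and pushouts, and whose admissible epimorphisms are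 closed under composition and pullbacks), and $\mathcal{E}^{\mathrm{E}}_{\mathcal{P}}=\mathcal{E}_{\mathcal{H}^{\mathrm{E}}}$. 3. Call $M\in\mathrm{mod}\,\mathcal{P}$ relatively projective if $\mathrm{Hom}_{\mathcal{P}}(M,g)$ is surjective for every right-hand map $g$ of a sequence in $\mathcal{E}^{\mathrm{E}}_{\mathcal{P}}$. Up to isomorphism, the indecomposable relatively projective $\mathcal{P}$-modules are exactly the elements of $\mathcal{H}^{\mathrm{E}}$, and the relatively projective $\mathcal{P}$-modules are exactly the finite direct sums (including the empty sum $0$) of elements of $\mathcal{H}^{\mathrm{E}}$. -/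

import Mathlib

open CategoryTheory CategoryTheory.Limits

noncomputable section

namespace PosetRep

universe u v w w'

section ExactStructures

variable {C : Type v} [Category.{w} C] [Abelian C]

/-- `f` is an admissible monomorphism for the class `𝓔`: it is the left map of a sequence
in `𝓔`. -/
def AdmissibleMono (𝓔 : ObjectProperty (ShortComplex C)) {A B : C} (f : A ⟶ B) : Prop :=
  ∃ (D : C) (g : B ⟶ D) (h : f ≫ g = 0), 𝓔 (ShortComplex.mk f g h)

/-- `g` is an admissible epimorphism for the class `𝓔`: it is the right map of a sequence
in `𝓔`. -/
def AdmissibleEpi (𝓔 : ObjectProperty (ShortComplex C)) {B D : C} (g : B ⟶ D) : Prop :=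
  ∃ (A : C) (f : A ⟶ B) (h : f ≫ g = 0), 𝓔 (ShortComplex.mk f g h)

/-- A class of short exact sequences of an abelian category is an exact structure (in the sense
of Quillen) on it. -/
structure IsExactStructure (𝓔 : ObjectProperty (ShortComplex C)) : Prop where
  shortExact : ∀ S, 𝓔 S → S.ShortExact
  of_iso : ∀ S T, (S ≅ T) → 𝓔 S → 𝓔 T
  of_split : ∀ S : ShortComplex C, Nonempty S.Splitting → 𝓔 S
  comp_mono : ∀ {X Y Z : C} (f : X ⟶ Y) (g : Y ⟶ Z),
    AdmissibleMono 𝓔 f → AdmissibleMono 𝓔 g → AdmissibleMono 𝓔 (f ≫ g)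
  comp_epi : ∀ {X Y Z : C} (f : X ⟶ Y) (g : Y ⟶ Z),
    AdmissibleEpi 𝓔 f → AdmissibleEpi 𝓔 g → AdmissibleEpi 𝓔 (f ≫ g)
  pushout : ∀ {X Y W Z : C} (f : X ⟶ Y) (h : X ⟶ W) (h' : Y ⟶ Z) (f' : W ⟶ Z),
    IsPushout f h h' f' → AdmissibleMono 𝓔 f → AdmissibleMono 𝓔 f'
  pullback : ∀ {W Z X Y : C} (h' : W ⟶ X) (f' : W ⟶ Z) (f : X ⟶ Y) (h : Z ⟶ Y),
    IsPullback h' f' f h → AdmissibleEpi 𝓔 f → AdmissibleEpi 𝓔 f'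

/-- The class of split short exact sequences. -/
def splitStructure (C : Type v) [Category.{w} C] [Abelian C] :
    ObjectProperty (ShortComplex C) :=
  fun S => Nonempty S.Splitting

/-- The class of short exact sequences on whose right map `Hom(U, -)` is surjective for all `U`
in `𝓤`. -/
def homSurjectiveStructure (𝓤 : ObjectProperty C) : ObjectProperty (ShortComplex C) :=
  fun S => S.ShortExact ∧
    ∀ U, 𝓤 U → Function.Surjective (fun t : U ⟶ S.X₂ => t ≫ S.g)

/-- The projective objects relative to `𝓔`: `Hom(M, -)` maps admissible epimorphisms to
surjections. -/
def RelProjective (𝓔 : ObjectProperty (ShortComplex C)) : ObjectProperty C :=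
  fun M => ∀ ⦃Y Z : C⦄ (g : Y ⟶ Z), AdmissibleEpi 𝓔 g →
    Function.Surjective (fun t : M ⟶ Y => t ≫ g)

attribute [local instance] Abelian.hasFiniteBiproducts

/-- Finite direct sums (including the empty one) of objects in `𝓤`, up to isomorphism. -/
def FiniteSums (𝓤 : ObjectProperty C) : ObjectProperty C :=
  fun M => ∃ (n : ℕ) (U : Fin n → C), (∀ i, 𝓤 (U i)) ∧ Nonempty (M ≅ ⨁ U)

end ExactStructures

/-- The category of representations of the poset `P` over the field `k`: functors from `P` to
finite-dimensional vector spaces. -/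
abbrev Rep (k : Type u) [Field k] (P : Type w) [PartialOrder P] : Type _ :=
  P ⥤ FGModuleCat.{u} k

/-- The set of isomorphism classes of indecomposable `P`-modules. -/
def Ind (k : Type u) [Field k] (P : Type w) [PartialOrder P] :
    Set (Quotient (isIsomorphicSetoid (Rep k P))) :=
  {c | ∃ M : Rep k P, Indecomposable M ∧ Quotient.mk _ M = c}

/-- `P` is of finite representation type over `k`. -/
def RepresentationFinite (k : Type u) [Field k] (P : Type w) [PartialOrder P] : Prop :=
  (Ind k P).Finite

section Embeddings

variable {X : Type w} {P : Type w'} [PartialOrder X] [PartialOrder P]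

/-- Two order-embeddings are equivalent if they differ by an automorphism of the source. -/
def embSetoid (X : Type w) (P : Type w') [PartialOrder X] [PartialOrder P] : Setoid (X ↪o P) where
  r f g := ∃ σ : X ≃o X, ∀ x, g x = f (σ x)
  iseqv :=
    { refl := fun _ => ⟨OrderIso.refl X, fun _ => rfl⟩
      symm := by
        rintro f g ⟨σ, h⟩
        exact ⟨σ.symm, fun x => by simp [h]⟩
      trans := by
        rintro f g l ⟨σ, h⟩ ⟨τ, h'⟩
        exact ⟨τ.trans σ, fun x => by simp [h, h']⟩ }

/-- Order-embeddings of `X` into `P` up to automorphisms of `X`. -/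
def Emb (X : Type w) (P : Type w') [PartialOrder X] [PartialOrder P] : Type _ :=
  Quotient (embSetoid X P)

/-- The class of an order-embedding modulo automorphisms of the source. -/
def Emb.mk (f : X ↪o P) : Emb X P := Quotient.mk (embSetoid X P) f

/-- An order-embedding as a functor. -/
abbrev embFunctor (f : X ↪o P) : X ⥤ P := f.monotone.functor

/-- The category of pairs `(x, f x ≤ p)` is the poset of all `x` with `f x ≤ p`. -/
def costructuredArrowEquiv (f : X ↪o P) (p : P) :
    CostructuredArrow (embFunctor f) p ≌ {x : X // f x ≤ p} where
  functor :=
    { obj := fun a => ⟨a.left, leOfHom a.hom⟩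
      map := fun φ => homOfLE (Subtype.mk_le_mk.mpr (leOfHom φ.left))
      map_id := fun _ => Subsingleton.elim _ _
      map_comp := fun _ _ => Subsingleton.elim _ _ }
  inverse :=
    { obj := fun x => CostructuredArrow.mk (Y := x.1) (homOfLE x.2)
      map := fun φ => CostructuredArrow.homMk (homOfLE (leOfHom φ)) (Subsingleton.elim _ _)
      map_id := fun _ => by ext; exact Subsingleton.elim _ _
      map_comp := fun _ _ => by ext; exact Subsingleton.elim _ _ }
  unitIso := NatIso.ofComponents
    (fun a => CostructuredArrow.isoMk (Iso.refl _) (Subsingleton.elim _ _))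
    (fun _ => by ext; exact Subsingleton.elim _ _)
  counitIso := NatIso.ofComponents (fun _ => Iso.refl _) (fun _ => Subsingleton.elim _ _)
  functor_unitIso_comp := fun _ => Subsingleton.elim _ _

variable (k : Type u) [Field k]

instance hasLeftKanExtension [Finite X] (f : X ↪o P) (U : Rep k X) :
    (embFunctor f).HasLeftKanExtension U := by
  have h : ∀ p, HasColimitsOfShape (CostructuredArrow (embFunctor f) p) (FGModuleCat.{u} k) := by
    intro p
    let _ : Fintype {x : X // f x ≤ p} := Fintype.ofFinite _
    exact hasColimitsOfShape_of_equivalence (costructuredArrowEquiv f p).symm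
  have : (embFunctor f).HasPointwiseLeftKanExtension U := fun p => by
    have := h p
    dsimp only [Functor.HasPointwiseLeftKanExtensionAt]
    infer_instance
  infer_instance

/-- The restriction functor `f^*`. -/
abbrev restriction (f : X ↪o P) : Rep k P ⥤ Rep k X :=
  (Functor.whiskeringLeft X P (FGModuleCat.{u} k)).obj (embFunctor f)

/-- The left adjoint `f_!` of the restriction functor `f^*` (left Kan extension along `f`). -/
def extension [Finite X] (f : X ↪o P) : Rep k X ⥤ Rep k P :=
  (embFunctor f).lan

/-- `f_!` is left adjoint to `f^*`. -/
def extensionAdjunction [Finite X] (f : X ↪o P) : extension k f ⊣ restriction k f :=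
  (embFunctor f).lanAdjunction (FGModuleCat.{u} k)

/-- The class of short exact sequences of `P`-modules whose restriction along every `f` in `E`
lies in `𝓔`. -/
def pullbackStructure (E : Set (Emb X P)) (𝓔 : ObjectProperty (ShortComplex (Rep k X))) :
    ObjectProperty (ShortComplex (Rep k P)) :=
  fun S => S.ShortExact ∧ ∀ f : X ↪o P, Emb.mk f ∈ E → 𝓔 (S.map (restriction k f))

/-- The exact structure of all short exact sequences of `P`-modules whose restriction along every
`f` in `E` splits. -/
def relStructure (E : Set (Emb X P)) : ObjectProperty (ShortComplex (Rep k P)) :=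
  pullbackStructure k E (splitStructure (Rep k X))

/-- The modules isomorphic to `f_! U` for some `f` in `E` and some indecomposable `X`-module
`U`. -/
def relHooks [Finite X] (E : Set (Emb X P)) : ObjectProperty (Rep k P) :=
  fun M => ∃ (f : X ↪o P) (U : Rep k X), Emb.mk f ∈ E ∧ Indecomposable U ∧
    Nonempty (M ≅ (extension k f).obj U)

end Embeddings

end PosetRep

end

/-! By the adjunction `f_! ⊣ f^*`, `Hom(f_! U, g)` is surjective iff `Hom(U, f^* g)` is. Every
`X`-module is a finite sum of indecomposables, so surjectivity for all indecomposable `U` lifts the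
identity of `f^* N` and splits the restricted sequence. This gives
`relStructure_eq_homSurjectiveStructure`, and exactness becomes the general
`isExactStructure_homSurjectiveStructure`.

Since `f` is fully faithful, `f^* f_! ≅ id`, whence `indecomposable_extension`.

Conversely, the sum of the counits `f_! f^* M ⟶ M` over `E` is an admissible epimorphism: the units
split it after each restriction, and it is epi because the images cover `P`. If `M` is relatively
projective it splits, so `𝟙 M` is a sum of maps through objects of `relHooks`. If `M` is also
indecomposable, `End M` is local, some summand is invertible, and `M` is isomorphic to such an
object. Projectives are a special case. -/

noncomputable section

namespace PosetRep

universe u v w w'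

/-! ### Fitting's lemma for finite-dimensional algebras -/

section Algebra

/-- In a finite-dimensional algebra without nontrivial idempotents, every element is a unit or
nilpotent (Fitting's lemma). -/
theorem isUnit_or_isNilpotent_of_finite (k : Type*) {A : Type*} [Field k] [Ring A] [Algebra k A]
    [Module.Finite k A] (hA : ∀ e : A, e * e = e → e = 0 ∨ e = 1) (a : A) :
    IsUnit a ∨ IsNilpotent a := by
  have ha : minpoly k a ≠ 0 := minpoly.ne_zero (IsIntegral.of_finite k a)
  obtain ⟨q, hq, hXq⟩ := Polynomial.exists_eq_pow_rootMultiplicity_mul_and_not_dvd _ ha 0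
  set n := (minpoly k a).rootMultiplicity 0
  rw [Polynomial.C_0, sub_zero] at hq hXq
  -- The Bézout term `u * X ^ (n + 1)` evaluates to an idempotent. The exponent is `n + 1` rather
  -- than `n` so that a factor `X` splits off even when `n = 0`, giving an inverse of `a` when the
  -- idempotent is `1`.
  have hcop : IsCoprime (Polynomial.X ^ (n + 1)) q :=
    ((Polynomial.irreducible_X.coprime_iff_not_dvd).mpr hXq).pow_left
  obtain ⟨u, v, huv⟩ := hcop
  let F := Polynomial.aeval (R := k) a
  have h0 : F (Polynomial.X ^ (n + 1) * q) = 0 := by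
    have : Polynomial.X ^ (n + 1) * q = Polynomial.X * minpoly k a := by
      conv_rhs => rw [hq]
      ring
    rw [this, map_mul, show F (minpoly k a) = 0 from minpoly.aeval k a, mul_zero]
  have hidem : F (u * Polynomial.X ^ (n + 1)) * F (u * Polynomial.X ^ (n + 1)) =
      F (u * Polynomial.X ^ (n + 1)) := by
    have : u * Polynomial.X ^ (n + 1) * (u * Polynomial.X ^ (n + 1)) =
        u * Polynomial.X ^ (n + 1) - u * v * (Polynomial.X ^ (n + 1) * q) := by
      linear_combination u * Polynomial.X ^ (n + 1) * huv
    rw [← map_mul, this, map_sub, map_mul F (u * v), h0, mul_zero, sub_zero]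
  rcases hA _ hidem with h | h
  · right
    refine ⟨n + 1, ?_⟩
    have h1 := congrArg F huv
    rw [map_add, h, zero_add, map_one] at h1
    have h2 := congrArg F
      (show Polynomial.X ^ (n + 1) * (v * q) = v * (Polynomial.X ^ (n + 1) * q) by ring)
    rw [map_mul F _ (v * q), h1, map_mul F v, h0, mul_zero, mul_one, map_pow] at h2
    rwa [← Polynomial.aeval_X (R := k) a]
  · left
    have h1 := congrArg F
      (show Polynomial.X * (u * Polynomial.X ^ n) = u * Polynomial.X ^ (n + 1) by ring)
    have h2 := congrArg F
      (show u * Polynomial.X ^ n * Polynomial.X = u * Polynomial.X ^ (n + 1) by ring)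
    rw [map_mul, h] at h1 h2
    rw [← Polynomial.aeval_X (R := k) a]
    exact isUnit_iff_exists.mpr ⟨_, h1, h2⟩

end Algebra

/-! ### Krull–Schmidt arguments in `Hom`-finite abelian categories -/

section Indecomposables

variable {C : Type v} [Category.{w} C] [Abelian C]

attribute [local instance] Abelian.hasFiniteBiproducts

theorem indecomposable_of_iso {M N : C} (e : M ≅ N) (hM : Indecomposable M) : Indecomposable N :=
  ⟨fun h => hM.1 (h.of_iso e), fun Y Z i => hM.2 Y Z (e ≪≫ i)⟩

/-- Two complementary retracts of an object decompose it as a biproduct. -/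
def isoBiprodOfTotal {M Y Z : C} {i : Y ⟶ M} {r : M ⟶ Y} {j : Z ⟶ M} {s : M ⟶ Z}
    (hi : i ≫ r = 𝟙 Y) (hj : j ≫ s = 𝟙 Z) (h : r ≫ i + s ≫ j = 𝟙 M) : M ≅ Y ⊞ Z where
  hom := biprod.lift r s
  inv := biprod.desc i j
  hom_inv_id := by simpa using h
  inv_hom_id := by
    have hr : i ≫ s = 0 := by
      have h1 := i ≫= h =≫ s
      simpa [reassoc_of% hi, hj] using h1
    have hs : j ≫ r = 0 := by
      have h1 := j ≫= h =≫ r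
      simpa [reassoc_of% hj, hi] using h1
    ext <;> simp [hi, hj, hr, hs]

theorem idempotent_eq_zero_or_id {M : C} (hM : Indecomposable M) {e : M ⟶ M} (he : e ≫ e = e) :
    e = 0 ∨ e = 𝟙 M := by
  obtain ⟨Y, i, r, hi, hr⟩ := IsIdempotentComplete.idempotents_split M e he
  obtain ⟨Z, j, s, hj, hs⟩ := IsIdempotentComplete.idempotents_split M (𝟙 M - e)
    (by simp [he])
  rcases hM.2 Y Z (isoBiprodOfTotal hi hj (by rw [hr, hs]; abel)) with h | h
  · left
    rw [← hr, h.eq_of_tgt r 0, zero_comp]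
  · right
    rw [h.eq_of_tgt s 0, zero_comp] at hs
    exact (sub_eq_zero.mp hs.symm).symm

/-- A nonzero retract of an indecomposable object is isomorphic to it. -/
theorem nonempty_iso_of_retract {M U : C} (hU : Indecomposable U) (hM : ¬ IsZero M)
    {i : M ⟶ U} {r : U ⟶ M} (h : i ≫ r = 𝟙 M) : Nonempty (M ≅ U) := by
  rcases idempotent_eq_zero_or_id hU (e := r ≫ i) (by simp [reassoc_of% h]) with h' | h'
  · refine absurd ?_ hM
    rw [IsZero.iff_id_eq_zero]
    calc 𝟙 M = i ≫ (r ≫ i) ≫ r := by simp [h]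
      _ = 0 := by simp [h']
  · exact ⟨⟨i, r, h, h'⟩⟩

variable (k : Type u) [Field k] [Linear k C]

theorem isLocalRing_end {M : C} [Module.Finite k (M ⟶ M)] (hM : Indecomposable M) :
    IsLocalRing (End M) := by
  have : Module.Finite k (End M) := ‹Module.Finite k (M ⟶ M)›
  have : Nontrivial (End M) := ⟨0, 1, fun h => hM.1 ((IsZero.iff_id_eq_zero M).mpr h.symm)⟩
  refine IsLocalRing.of_isUnit_or_isUnit_one_sub_self fun a => ?_
  exact (isUnit_or_isNilpotent_of_finite k (A := End M) (fun e he => idempotent_eq_zero_or_id hM he) a).imp_right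
    fun h => h.isUnit_one_sub

/-- The homomorphisms that are sums of homomorphisms factoring through an object in `𝓤`. -/
def factoringThrough (𝓤 : ObjectProperty C) (M N : C) : AddSubgroup (M ⟶ N) :=
  AddSubgroup.closure {h | ∃ (U : C) (a : M ⟶ U) (b : U ⟶ N), 𝓤 U ∧ a ≫ b = h}

/-- `factoringThrough 𝓤` is a two-sided ideal. Membership of `𝟙 M` encodes that `M` is a direct
summand of a finite sum of objects in `𝓤`, without choosing such a sum. -/
theorem comp_mem_factoringThrough {𝓤 : ObjectProperty C} {M' M N N' : C} (a : M' ⟶ M)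
    {h : M ⟶ N} (hh : h ∈ factoringThrough 𝓤 M N) (b : N ⟶ N') :
    a ≫ h ≫ b ∈ factoringThrough 𝓤 M' N' := by
  induction hh using AddSubgroup.closure_induction with
  | mem x hx =>
    obtain ⟨U, c, d, hU, rfl⟩ := hx
    exact AddSubgroup.subset_closure ⟨U, a ≫ c, d ≫ b, hU, by simp⟩
  | zero => simp
  | add x y _ _ hx hy => simpa using add_mem hx hy
  | neg x _ hx => simpa using neg_mem hx

theorem id_mem_factoringThrough_of_finiteSums {𝓤 : ObjectProperty C} {M : C}
    (hM : FiniteSums 𝓤 M) : 𝟙 M ∈ factoringThrough 𝓤 M M := by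
  obtain ⟨n, U, hU, ⟨e⟩⟩ := hM
  have h : 𝟙 M = e.hom ≫ 𝟙 _ ≫ e.inv := by simp
  rw [h]
  refine comp_mem_factoringThrough _ ?_ _
  rw [← biproduct.total]
  exact sum_mem fun j _ => AddSubgroup.subset_closure ⟨U j, _, _, hU j, rfl⟩

/-- An indecomposable direct summand of a finite sum of indecomposable objects is isomorphic to
one of them. -/
theorem exists_iso_of_id_mem_factoringThrough {𝓤 : ObjectProperty C} (h𝓤 : 𝓤 ≤ Indecomposable)
    {M : C} [Module.Finite k (M ⟶ M)] (hM : Indecomposable M)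
    (h : 𝟙 M ∈ factoringThrough 𝓤 M M) : ∃ U, 𝓤 U ∧ Nonempty (M ≅ U) := by
  have := isLocalRing_end k hM
  by_contra! hcon
  -- Non-units of a local ring are closed under addition, so only single factorizations matter; an
  -- invertible one would make `M` a retract of an indecomposable `U`.
  suffices H : ∀ x ∈ factoringThrough 𝓤 M M, ¬ IsUnit (M := End M) x from H _ h isUnit_one
  intro x hx
  induction hx using AddSubgroup.closure_induction with
  | mem x hx =>
    obtain ⟨U, a, b, hU, rfl⟩ := hx
    intro hab
    have hiso : IsIso (a ≫ b) := (isUnit_iff_isIso _).mp hab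
    obtain ⟨e⟩ := nonempty_iso_of_retract (h𝓤 U hU) hM.1 (i := a) (r := b ≫ inv (a ≫ b))
      (by rw [← Category.assoc, IsIso.hom_inv_id])
    exact (hcon U hU).false e
  | zero => exact not_isUnit_zero
  | add x y _ _ hx hy => exact fun hxy =>
      (IsLocalRing.isUnit_or_isUnit_of_isUnit_add (R := End M) hxy).elim hx hy
  | neg x _ hx => exact fun h => hx ((IsUnit.neg_iff (α := End M) x).mp h)

theorem lifts_of_id_mem_factoringThrough {𝓤 : ObjectProperty C} {M Y Z : C} {g : Y ⟶ Z}
    (hg : ∀ U, 𝓤 U → Function.Surjective (fun t : U ⟶ Y => t ≫ g))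
    (h : 𝟙 M ∈ factoringThrough 𝓤 M M) : Function.Surjective (fun t : M ⟶ Y => t ≫ g) := by
  intro t
  suffices H : ∀ x ∈ factoringThrough 𝓤 M M, ∃ s : M ⟶ Y, s ≫ g = x ≫ t by simpa using H _ h
  intro x hx
  induction hx using AddSubgroup.closure_induction with
  | mem x hx =>
    obtain ⟨U, a, b, hU, rfl⟩ := hx
    obtain ⟨s, hs⟩ := hg U hU (b ≫ t)
    exact ⟨a ≫ s, by simpa using a ≫= hs⟩
  | zero => exact ⟨0, by simp⟩
  | add x y _ _ hx hy =>
    obtain ⟨s, hs⟩ := hx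
    obtain ⟨s', hs'⟩ := hy
    exact ⟨s + s', by simp [hs, hs']⟩
  | neg x _ hx =>
    obtain ⟨s, hs⟩ := hx
    exact ⟨-s, by simp [hs]⟩

theorem FiniteSums.of_isZero {𝓤 : ObjectProperty C} {M : C} (hM : IsZero M) : FiniteSums 𝓤 M :=
  ⟨0, Fin.elim0, fun i => i.elim0, ⟨hM.iso ((IsZero.iff_id_eq_zero _).mpr
    (biproduct.hom_ext _ _ fun j => j.elim0))⟩⟩

theorem FiniteSums.of_mem {𝓤 : ObjectProperty C} {M : C} (hM : 𝓤 M) : FiniteSums 𝓤 M :=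
  ⟨1, fun _ => M, fun _ => hM, ⟨(biproductUniqueIso (fun _ : Fin 1 => M)).symm⟩⟩

/-- A biproduct indexed by a disjoint union is the biproduct of the two partial biproducts. -/
def biprodBiproductIso {m n : ℕ} (W : Fin m ⊕ Fin n → C) :
    (⨁ fun i => W (Sum.inl i)) ⊞ (⨁ fun i => W (Sum.inr i)) ≅ ⨁ W where
  hom := biprod.desc (biproduct.desc fun i => biproduct.ι W (Sum.inl i))
    (biproduct.desc fun i => biproduct.ι W (Sum.inr i))
  inv := biproduct.desc (fun
    | Sum.inl i => biproduct.ι (fun i => W (Sum.inl i)) i ≫ biprod.inl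
    | Sum.inr i => biproduct.ι (fun i => W (Sum.inr i)) i ≫ biprod.inr)
  hom_inv_id := by
    apply biprod.hom_ext' <;> apply biproduct.hom_ext' <;> intro i <;> simp
  inv_hom_id := by
    apply biproduct.hom_ext'
    rintro (i | i) <;> simp

theorem FiniteSums.biprod {𝓤 : ObjectProperty C} {M Y Z : C} (e : M ≅ Y ⊞ Z)
    (hY : FiniteSums 𝓤 Y) (hZ : FiniteSums 𝓤 Z) : FiniteSums 𝓤 M := by
  obtain ⟨m, U, hU, ⟨a⟩⟩ := hY
  obtain ⟨n, V, hV, ⟨b⟩⟩ := hZ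
  let W : Fin m ⊕ Fin n → C := Sum.elim U V
  refine ⟨m + n, W ∘ finSumFinEquiv.symm, fun i => ?_,
    ⟨e ≪≫ biprod.mapIso a b ≪≫ biprodBiproductIso W ≪≫ (biproduct.reindex finSumFinEquiv.symm W).symm⟩⟩
  rcases h : finSumFinEquiv.symm i with j | j
  · simpa [h, W] using hU j
  · simpa [h, W] using hV j

/-- `End Y × End Z` embeds in `End M` as diagonal blocks, and `End Z ≠ 0`. This makes `dim End` a
measure for induction on decompositions. -/
theorem finrank_end_lt {M Y Z : C} [Module.Finite k (M ⟶ M)] [Module.Finite k (Y ⟶ Y)]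
    [Module.Finite k (Z ⟶ Z)] (e : M ≅ Y ⊞ Z) (hZ : ¬ IsZero Z) :
    Module.finrank k (Y ⟶ Y) < Module.finrank k (M ⟶ M) := by
  have : Nontrivial (Z ⟶ Z) := ⟨𝟙 Z, 0, fun h => hZ ((IsZero.iff_id_eq_zero Z).mpr h)⟩
  have hpos : 0 < Module.finrank k (Z ⟶ Z) := Module.finrank_pos
  let φ : ((Y ⟶ Y) × (Z ⟶ Z)) →ₗ[k] (M ⟶ M) :=
    { toFun := fun a => e.hom ≫ biprod.map a.1 a.2 ≫ e.inv
      map_add' := fun a b => by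
        rw [← Preadditive.comp_add, ← Preadditive.add_comp]
        congr 2
        ext <;> simp
      map_smul' := fun r a => by
        rw [RingHom.id_apply, ← Linear.comp_smul, ← Linear.smul_comp]
        congr 2
        ext <;> simp }
  have hφ : Function.Injective φ := by
    intro a b h
    have h1 : biprod.map a.1 a.2 = biprod.map b.1 b.2 := by
      simpa [φ] using h
    ext
    · simpa using biprod.inl ≫= h1 =≫ biprod.fst
    · simpa using biprod.inr ≫= h1 =≫ biprod.snd
  have := LinearMap.finrank_le_finrank_of_injective hφ
  rw [Module.finrank_prod] at this
  omega

/-- In a `Hom`-finite abelian category, every object is a finite direct sum of indecomposable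
objects. -/
theorem finiteSums_indecomposable (hfin : ∀ M : C, Module.Finite k (M ⟶ M)) (M : C) :
    FiniteSums Indecomposable M := by
  induction hn : Module.finrank k (M ⟶ M) using Nat.strong_induction_on generalizing M with
  | _ n ih =>
    by_cases h0 : IsZero M
    · exact .of_isZero h0
    by_cases hM : Indecomposable M
    · exact .of_mem hM
    obtain ⟨Y, Z, e, hY, hZ⟩ : ∃ (Y Z : C) (_ : M ≅ Y ⊞ Z), ¬ IsZero Y ∧ ¬ IsZero Z := by
      by_contra! hcon
      exact hM ⟨h0, fun Y Z e => or_iff_not_imp_left.mpr (hcon Y Z e)⟩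
    exact .biprod e (ih _ (hn ▸ finrank_end_lt k e hZ) Y rfl)
      (ih _ (hn ▸ finrank_end_lt k (e ≪≫ biprod.braiding Y Z) hY) Z rfl)

end Indecomposables

/-! ### Exact structures defined by surjectivity of `Hom(U, -)` -/

section HomSurjective

variable {C : Type v} [Category.{w} C] [Abelian C] {𝓤 : ObjectProperty C}

theorem admissibleEpi_homSurjectiveStructure_iff {Y Z : C} (g : Y ⟶ Z) :
    AdmissibleEpi (homSurjectiveStructure 𝓤) g ↔
      Epi g ∧ ∀ U, 𝓤 U → Function.Surjective (fun t : U ⟶ Y => t ≫ g) := by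
  constructor
  · rintro ⟨A, f, h, hS, hU⟩
    exact ⟨hS.epi_g, hU⟩
  · rintro ⟨_, hU⟩
    exact ⟨_, kernel.ι g, kernel.condition g,
      { exact := ShortComplex.exact_of_f_is_kernel _ (kernelIsKernel g) }, hU⟩

/-- Any right map completing `f` to a short exact sequence is a cokernel of `f`, so the canonical
cokernel can be tested instead. -/
theorem admissibleMono_homSurjectiveStructure_iff {X Y : C} (f : X ⟶ Y) :
    AdmissibleMono (homSurjectiveStructure 𝓤) f ↔
      Mono f ∧ ∀ U, 𝓤 U → Function.Surjective (fun t : U ⟶ Y => t ≫ cokernel.π f) := by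
  constructor
  · rintro ⟨D, g, h, hS, hU⟩
    refine ⟨hS.mono_f, fun U hUU t => ?_⟩
    have := hS.epi_g
    obtain ⟨s, hs⟩ := hU U hUU (t ≫ cokernel.desc f g h)
    refine ⟨s, ?_⟩
    have hmono : Mono (cokernel.desc f g h) := hS.exact.mono_cokernelDesc
    rw [← cancel_mono (cokernel.desc f g h)]
    simpa using hs
  · rintro ⟨_, hU⟩
    exact ⟨_, cokernel.π f, cokernel.condition f,
      { exact := ShortComplex.exact_of_g_is_cokernel _ (cokernelIsCokernel f) }, hU⟩

variable (𝓤) in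
/-- For every class `𝓤` of objects of an abelian category, the short exact sequences on which
`Hom(U, -)` is exact for all `U` in `𝓤` form an exact structure. -/
theorem isExactStructure_homSurjectiveStructure :
    IsExactStructure (homSurjectiveStructure 𝓤) where
  shortExact := fun _ h => h.1
  of_iso := by
    rintro S T e ⟨hS, hU⟩
    refine ⟨ShortComplex.shortExact_of_iso e hS, fun U hUU t => ?_⟩
    obtain ⟨s, hs⟩ := hU U hUU (t ≫ e.inv.τ₃)
    refine ⟨s ≫ e.hom.τ₂, ?_⟩
    have h := hs =≫ e.hom.τ₃
    simp only [Category.assoc, ← ShortComplex.comp_τ₃, e.inv_hom_id, ShortComplex.id_τ₃,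
      Category.comp_id] at h
    simpa [e.hom.comm₂₃] using h
  of_split := by
    rintro S ⟨σ⟩
    exact ⟨σ.shortExact, fun U _ t => ⟨t ≫ σ.s, by simp⟩⟩
  comp_mono := by
    intro X Y Z f g
    simp only [admissibleMono_homSurjectiveStructure_iff]
    rintro ⟨_, hf⟩ ⟨_, hg⟩
    refine ⟨inferInstance, fun U hU t => ?_⟩
    -- In `0 → coker f → coker (f ≫ g) → coker g → 0`, lift the image of `t` in `coker g` first; the
    -- remaining error comes from `coker f` and is lifted there.
    let j := cokernel.map f (f ≫ g) (𝟙 X) g (by simp)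
    let r := cokernel.map (f ≫ g) g f (𝟙 Z) (by simp)
    have hex : (ShortComplex.mk j r (by ext; simp [j, r])).Exact :=
      (kernelCokernelCompSequence_exact f g).exact 3
    have : Mono j := by
      have h2 := (kernelCokernelCompSequence_exact f g).exact 2
      exact h2.mono_g ((isZero_kernel_of_mono g).eq_of_src _ _)
    obtain ⟨s, hs⟩ := hg U hU (t ≫ r)
    obtain ⟨t', ht'⟩ : ∃ t', t' ≫ j = t - s ≫ cokernel.π (f ≫ g) :=
      ⟨hex.lift (t - s ≫ cokernel.π (f ≫ g)) (by
        have : t ≫ r = s ≫ cokernel.π g := hs.symm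
        simp [this, r]), hex.lift_f _ _⟩
    obtain ⟨s', hs'⟩ := hf U hU t'
    have hs'' : s' ≫ cokernel.π f = t' := hs'
    refine ⟨s + s' ≫ g, ?_⟩
    have h1 : s' ≫ g ≫ cokernel.π (f ≫ g) = t' ≫ j := by simp [← hs'', j]
    simp [h1, ht']
  comp_epi := by
    intro X Y Z f g
    simp only [admissibleEpi_homSurjectiveStructure_iff]
    rintro ⟨_, hf⟩ ⟨_, hg⟩
    refine ⟨inferInstance, fun U hU t => ?_⟩
    obtain ⟨s, hs⟩ := hg U hU t
    obtain ⟨s', hs'⟩ := hf U hU s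
    exact ⟨s', by simpa [← hs'] using hs⟩
  pushout := by
    intro X Y W Z f h h' f' hsq
    simp only [admissibleMono_homSurjectiveStructure_iff]
    rintro ⟨_, hf⟩
    refine ⟨Abelian.mono_inr_of_isColimit _ h hsq.isColimit, fun U hU t => ?_⟩
    -- A pushout preserves the cokernel; only `i ≫ j = 𝟙` is needed to transport the lift.
    let j : cokernel f ⟶ cokernel f' := cokernel.map f f' h h' hsq.w
    let i : cokernel f' ⟶ cokernel f :=
      cokernel.desc f' (hsq.desc (cokernel.π f) 0 (by simp)) (by simp)
    have hij : i ≫ j = 𝟙 _ := by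
      ext
      apply hsq.hom_ext <;> simp [i, j]
    obtain ⟨s, hs⟩ := hf U hU (t ≫ i)
    have hs' : s ≫ cokernel.π f = t ≫ i := hs
    refine ⟨s ≫ h', ?_⟩
    calc (s ≫ h') ≫ cokernel.π f' = (s ≫ cokernel.π f) ≫ j := by simp [j]
      _ = t := by rw [hs', Category.assoc, hij, Category.comp_id]
  pullback := by
    intro W Z X Y h' f' f h hsq
    simp only [admissibleEpi_homSurjectiveStructure_iff]
    rintro ⟨_, hf⟩
    refine ⟨Abelian.epi_snd_of_isLimit _ h hsq.isLimit, fun U hU t => ?_⟩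
    obtain ⟨s, hs⟩ := hf U hU (t ≫ h)
    exact ⟨hsq.lift s t hs, by simp⟩

end HomSurjective

/-! ### Restriction, extension and relative projectives for poset modules -/

section Modules

variable (k : Type u) [Field k] {X : Type w} {P : Type w'} [PartialOrder X] [PartialOrder P]

instance finite_hom [Finite P] (M N : Rep k P) : Module.Finite k (M ⟶ N) := by
  let φ : (M ⟶ N) →ₗ[k] (∀ p, M.obj p ⟶ N.obj p) :=
    { toFun := fun t p => t.app p
      map_add' := fun _ _ => rfl
      map_smul' := fun _ _ => rfl }
  exact Module.Finite.of_injective φ fun a b h => NatTrans.ext h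

instance additive_extension [Finite X] (f : X ↪o P) : (extension k f).Additive :=
  (extensionAdjunction k f).left_adjoint_additive

instance full_embFunctor (f : X ↪o P) : (embFunctor f).Full where
  map_surjective := fun t => ⟨homOfLE (f.le_iff_le.mp (leOfHom t)), Subsingleton.elim _ _⟩

instance faithful_embFunctor (f : X ↪o P) : (embFunctor f).Faithful where
  map_injective := fun _ => Subsingleton.elim _ _

instance hasPointwiseLeftKanExtension [Finite X] (f : X ↪o P) (U : Rep k X) :
    (embFunctor f).HasPointwiseLeftKanExtension U := fun p => by
  let _ : Fintype {x : X // f x ≤ p} := Fintype.ofFinite _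
  have : HasColimitsOfShape (CostructuredArrow (embFunctor f) p) (FGModuleCat.{u} k) :=
    hasColimitsOfShape_of_equivalence (costructuredArrowEquiv f p).symm
  dsimp only [Functor.HasPointwiseLeftKanExtensionAt]
  infer_instance

/-- Extending a module along an order-embedding and restricting it again gives it back. -/
def restrictionExtensionIso [Finite X] (f : X ↪o P) (U : Rep k X) :
    (restriction k f).obj ((extension k f).obj U) ≅ U :=
  -- The unit of a left Kan extension along a fully faithful functor is invertible.
  have : IsIso ((extensionAdjunction k f).unit.app U) := by
    have : IsIso ((embFunctor f).lanUnit.app U) := inferInstance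
    rwa [← Functor.lanAdjunction_unit] at this
  (asIso ((extensionAdjunction k f).unit.app U)).symm

variable {k}

/-- A map `f_! U ⟶ Y` is determined by its adjoint `U ⟶ f^* Y`, so the retraction vanishes. -/
theorem isZero_of_retract_extension [Finite X] {f : X ↪o P} {U : Rep k X} {Y : Rep k P}
    {i : Y ⟶ (extension k f).obj U} {r : (extension k f).obj U ⟶ Y} (h : i ≫ r = 𝟙 Y)
    (hY : IsZero ((restriction k f).obj Y)) : IsZero Y := by
  have hr : r = 0 := ((extensionAdjunction k f).homEquiv U Y).injective (hY.eq_of_tgt _ _)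
  rw [IsZero.iff_id_eq_zero, ← h, hr, comp_zero]

/-- Restricting a decomposition of `f_! U` decomposes `U`, so one summand restricts to zero and is
therefore zero. -/
theorem indecomposable_extension [Finite X] (f : X ↪o P) {U : Rep k X} (hU : Indecomposable U) :
    Indecomposable ((extension k f).obj U) := by
  refine ⟨fun h => hU.1 (((restriction k f).map_isZero h).of_iso
    (restrictionExtensionIso k f U).symm), fun Y Z e => ?_⟩
  have := preservesBinaryBiproducts_of_preservesBiproducts (restriction k f)
  refine (hU.2 _ _ ((restrictionExtensionIso k f U).symm ≪≫ (restriction k f).mapIso e ≪≫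
    (restriction k f).mapBiprod Y Z)).imp (fun h => ?_) (fun h => ?_)
  · exact isZero_of_retract_extension (i := biprod.inl ≫ e.inv) (r := e.hom ≫ biprod.fst)
      (by simp) h
  · exact isZero_of_retract_extension (i := biprod.inr ≫ e.inv) (r := e.hom ≫ biprod.snd)
      (by simp) h

theorem surjective_extension_iff [Finite X] (f : X ↪o P) (U : Rep k X) {Y Z : Rep k P}
    (g : Y ⟶ Z) :
    Function.Surjective (fun t : (extension k f).obj U ⟶ Y => t ≫ g) ↔
      Function.Surjective (fun t : U ⟶ (restriction k f).obj Y => t ≫ (restriction k f).map g) := by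
  let adj := extensionAdjunction k f
  have h : (fun t : U ⟶ (restriction k f).obj Y => t ≫ (restriction k f).map g) ∘
      adj.homEquiv U Y = adj.homEquiv U Z ∘ (fun t : (extension k f).obj U ⟶ Y => t ≫ g) := by
    ext1 t
    exact (adj.homEquiv_naturality_right t g).symm
  rw [← (adj.homEquiv U Z).comp_surjective, ← h, (adj.homEquiv U Y).surjective_comp]

variable {E : Set (Emb X P)}

theorem relHooks_le_indecomposable [Finite X] : relHooks k E ≤ Indecomposable := by
  rintro M ⟨f, U, -, hU, ⟨e⟩⟩
  exact indecomposable_of_iso e.symm (indecomposable_extension f hU)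

theorem relStructure_eq_homSurjectiveStructure [Finite X] :
    relStructure k E = homSurjectiveStructure (relHooks k E) := by
  ext S
  constructor
  · rintro ⟨hS, h⟩
    refine ⟨hS, ?_⟩
    rintro M ⟨f, U, hf, -, ⟨e⟩⟩ t
    obtain ⟨σ⟩ := h f hf
    obtain ⟨s, hs⟩ := (surjective_extension_iff f U S.g).mpr
      (fun t => ⟨t ≫ σ.s,
        (Category.assoc _ _ _).trans ((t ≫= σ.s_g).trans (Category.comp_id _))⟩) (e.inv ≫ t)
    have hs' : s ≫ S.g = e.inv ≫ t := hs
    exact ⟨e.hom ≫ s, by simp [hs']⟩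
  · rintro ⟨hS, h⟩
    refine ⟨hS, fun f hf => ?_⟩
    have hSf := hS.map_of_exact (restriction k f)
    -- Lifting the identity of `f^* S.X₃` produces the section.
    obtain ⟨s, hs⟩ := lifts_of_id_mem_factoringThrough (𝓤 := Indecomposable)
      (fun U hU => (surjective_extension_iff f U S.g).mp
        (h _ ⟨f, U, hf, hU, ⟨Iso.refl _⟩⟩))
      (id_mem_factoringThrough_of_finiteSums
        (finiteSums_indecomposable k (fun _ => inferInstance) ((restriction k f).obj S.X₃)))
      (𝟙 _)
    exact ⟨ShortComplex.Splitting.ofExactOfSection _ hSf.exact s hs hSf.mono_f⟩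

theorem isExactStructure_relStructure [Finite X] : IsExactStructure (relStructure k E) := by
  rw [relStructure_eq_homSurjectiveStructure]
  exact isExactStructure_homSurjectiveStructure _

theorem relProjective_of_relHooks [Finite X] : relHooks k E ≤ RelProjective (relStructure k E) := by
  intro M hM Y Z g hg
  rw [relStructure_eq_homSurjectiveStructure, admissibleEpi_homSurjectiveStructure_iff] at hg
  exact hg.2 M hM

attribute [local instance] Abelian.hasFiniteBiproducts

/-- The sum of the counits `f_! f^* M ⟶ M` over `f` in `E` is an admissible epimorphism when the
images of the embeddings in `E` cover `P`. -/
theorem admissibleEpi_desc_counit [Finite X]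
    (hE : ∀ p : P, ∃ f : X ↪o P, Emb.mk f ∈ E ∧ p ∈ Set.range f) {n : ℕ} (F : Fin n → (X ↪o P))
    (hF : ∀ f, Emb.mk f ∈ E → ∃ i, F i = f) (M : Rep k P) :
    AdmissibleEpi (relStructure k E) (biproduct.desc
      (f := fun i => (extension k (F i)).obj ((restriction k (F i)).obj M))
      fun i => (extensionAdjunction k (F i)).counit.app M) := by
  set g := biproduct.desc (f := fun i => (extension k (F i)).obj ((restriction k (F i)).obj M))
      fun i => (extensionAdjunction k (F i)).counit.app M
  have hsec : ∀ f, Emb.mk f ∈ E → ∃ s, s ≫ (restriction k f).map g = 𝟙 _ := by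
    intro f hf
    obtain ⟨i, rfl⟩ := hF f hf
    -- By the triangle identity, the unit into the `i`-th summand is a section after restriction
    -- along `F i`.
    refine ⟨(extensionAdjunction k (F i)).unit.app ((restriction k (F i)).obj M) ≫
      (restriction k (F i)).map (biproduct.ι
        (fun i => (extension k (F i)).obj ((restriction k (F i)).obj M)) i), ?_⟩
    rw [Category.assoc, ← Functor.map_comp, biproduct.ι_desc]
    exact (extensionAdjunction k (F i)).right_triangle_components M
  have hg : Epi g := by
    rw [NatTrans.epi_iff_epi_app]
    intro p
    obtain ⟨f, hf, x, rfl⟩ := hE p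
    obtain ⟨s, hs⟩ := hsec f hf
    exact (SplitEpi.mk (s.app x) (congr_app hs x)).epi
  have hS : (ShortComplex.mk (kernel.ι g) g (kernel.condition g)).ShortExact :=
    { exact := ShortComplex.exact_of_f_is_kernel _ (kernelIsKernel g) }
  refine ⟨_, kernel.ι g, kernel.condition g, hS, fun f hf => ?_⟩
  have hSf := hS.map_of_exact (restriction k f)
  obtain ⟨s, hs⟩ := hsec f hf
  exact ⟨ShortComplex.Splitting.ofExactOfSection _ hSf.exact s hs hSf.mono_f⟩

theorem map_extension_mem_factoringThrough [Finite X] {f : X ↪o P} (hf : Emb.mk f ∈ E)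
    {U V : Rep k X} {h : U ⟶ V} (hh : h ∈ factoringThrough Indecomposable U V) :
    (extension k f).map h ∈ factoringThrough (relHooks k E) _ _ := by
  induction hh using AddSubgroup.closure_induction with
  | mem x hx =>
    obtain ⟨W, a, b, hW, rfl⟩ := hx
    exact AddSubgroup.subset_closure ⟨_, (extension k f).map a, (extension k f).map b,
      ⟨f, W, hf, hW, ⟨Iso.refl _⟩⟩, by simp⟩
  | zero => simp
  | add x y _ _ hx hy => simpa using add_mem hx hy
  | neg x _ hx => simpa using neg_mem hx

theorem id_mem_factoringThrough_relHooks [Finite X] [Finite P]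
    (hE : ∀ p : P, ∃ f : X ↪o P, Emb.mk f ∈ E ∧ p ∈ Set.range f) {M : Rep k P}
    (hM : RelProjective (relStructure k E) M) :
    𝟙 M ∈ factoringThrough (relHooks k E) M M := by
  -- The sum is indexed by all embeddings whose class lies in `E`, not by one representative per
  -- class; there are finitely many.
  have : Finite (X ↪o P) := DFunLike.finite _
  obtain ⟨n, ⟨ε⟩⟩ := Finite.exists_equiv_fin {f : X ↪o P // Emb.mk f ∈ E}
  obtain ⟨s, hs⟩ := hM _ (admissibleEpi_desc_counit hE (fun i => (ε.symm i).1)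
    (fun f hf => ⟨ε ⟨f, hf⟩, by simp⟩) M) (𝟙 M)
  rw [← hs]
  dsimp only
  rw [biproduct.desc_eq, Preadditive.comp_sum]
  refine sum_mem fun i _ => ?_
  -- The identity of `f_! f^* M` is in the ideal, hence so is each composite `M ⟶ f_! f^* M ⟶ M`.
  have h := map_extension_mem_factoringThrough (ε.symm i).2 (id_mem_factoringThrough_of_finiteSums
    (finiteSums_indecomposable k (fun _ => inferInstance) ((restriction k (ε.symm i).1).obj M)))
  rw [CategoryTheory.Functor.map_id] at h
  simpa using comp_mem_factoringThrough (s ≫ biproduct.π _ i) h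
    ((extensionAdjunction k (ε.symm i).1).counit.app M)

theorem relHooks_of_relProjective [Finite X] [Finite P]
    (hE : ∀ p : P, ∃ f : X ↪o P, Emb.mk f ∈ E ∧ p ∈ Set.range f) {M : Rep k P}
    (hM : Indecomposable M) (hM' : RelProjective (relStructure k E) M) : relHooks k E M := by
  obtain ⟨N, ⟨f, U, hf, hU, ⟨e⟩⟩, ⟨e'⟩⟩ := exists_iso_of_id_mem_factoringThrough k
    relHooks_le_indecomposable hM (id_mem_factoringThrough_relHooks hE hM')
  exact ⟨f, U, hf, hU, ⟨e' ≪≫ e⟩⟩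

theorem relProjective_of_projective (M : Rep k P) [Projective M] :
    RelProjective (relStructure k E) M := by
  rintro Y Z g ⟨A, f, h, hS, -⟩ t
  have := hS.epi_g
  exact ⟨Projective.factorThru t g, Projective.factorThru_comp t g⟩

theorem relProjective_eq_finiteSums [Finite X] [Finite P]
    (hE : ∀ p : P, ∃ f : X ↪o P, Emb.mk f ∈ E ∧ p ∈ Set.range f) :
    RelProjective (relStructure k E) = FiniteSums (relHooks k E) := by
  ext M
  constructor
  · intro hM
    obtain ⟨n, U, hU, ⟨e⟩⟩ := finiteSums_indecomposable k (fun _ => inferInstance) M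
    -- Relative projectivity passes to direct summands, so each indecomposable summand of `M` is
    -- covered by the indecomposable case.
    refine ⟨n, U, fun i => relHooks_of_relProjective hE (hU i) fun Y Z g hg t => ?_, ⟨e⟩⟩
    obtain ⟨s, hs⟩ := hM g hg (e.hom ≫ biproduct.π U i ≫ t)
    have hs' : s ≫ g = e.hom ≫ biproduct.π U i ≫ t := hs
    exact ⟨biproduct.ι U i ≫ e.inv ≫ s, by simp [hs']⟩
  · intro hM Y Z g hg
    exact lifts_of_id_mem_factoringThrough (fun U hU => relProjective_of_relHooks U hU g hg)
      (id_mem_factoringThrough_of_finiteSums hM)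

end Modules

end PosetRep

end

theorem mainTheorem3 (k : Type*) [Field k]
    (X : Type*) (P : Type*) [PartialOrder X] [PartialOrder P] [Finite X] [Finite P]
    (hX : PosetRep.RepresentationFinite k X)
    (E : Set (PosetRep.Emb X P))
    (hE : ∀ p : P, ∃ f : X ↪o P, PosetRep.Emb.mk f ∈ E ∧ p ∈ Set.range f) :
    PosetRep.relHooks k E ≤ Indecomposable ∧
    (∀ M : PosetRep.Rep k P, Indecomposable M → Projective M → PosetRep.relHooks k E M) ∧
    PosetRep.IsExactStructure (PosetRep.relStructure k E) ∧
    PosetRep.relStructure k E = PosetRep.homSurjectiveStructure (PosetRep.relHooks k E) ∧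
    (∀ M : PosetRep.Rep k P,
      (Indecomposable M ∧ PosetRep.RelProjective (PosetRep.relStructure k E) M) ↔
        PosetRep.relHooks k E M) ∧
    PosetRep.RelProjective (PosetRep.relStructure k E) =
      PosetRep.FiniteSums (PosetRep.relHooks k E) :=
  ⟨PosetRep.relHooks_le_indecomposable,
    fun M hM _ => PosetRep.relHooks_of_relProjective hE hM (PosetRep.relProjective_of_projective M),
    PosetRep.isExactStructure_relStructure,
    PosetRep.relStructure_eq_homSurjectiveStructure,
    fun M => ⟨fun h => PosetRep.relHooks_of_relProjective hE h.1 h.2,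
      fun h => ⟨PosetRep.relHooks_le_indecomposable M h, PosetRep.relProjective_of_relHooks M h⟩⟩,
    PosetRep.relProjective_eq_finiteSums hE⟩
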